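/- Let $\mathbb{D}=\{z\in\mathbb{C}:|z|<1\}$. For real $\alpha,\beta,\gamma$ put $$\mathcal{T}_{\alpha,\beta,\gamma}(z)=1+\frac{(2-2\gamma)z}{(1-\alpha z)(1-\beta z)}\qquad(z\in\mathbb{D}),$$ and $$\mathcal{T}_0(\alpha,\beta)=\begin{cases}1-\dfrac{(1-\alpha\beta)\left[2\sqrt{\alpha\beta(1-\alpha^2)(1-\beta^2)}+(\alpha+\beta)(1-\alpha\beta)\right]}{(1+\alpha\beta)^2}&\text{if }0<\alpha<1\text{ and }\beta_1(\alpha)<\beta<1,\\[2mm] 1-\dfrac{(1+\alpha)(1+\beta)}{2}&\text{otherwise,}\end{cases}$$ where $$\beta_1(\alpha)=\frac{(1+\alpha)\sqrt{\alpha^2+14\alpha+1}-(\alpha^2+6\alpha+1)}{2\alpha(1-\alpha)}.$$ Let $-1<\alpha<\beta<1$ and $0\le\gamma<1$ with $\gamma\ge\mathcal{T}_0(\alpha,\beta)$. Let $\mathcal{CV}_{snail}(\alpha,\beta,\gamma)$ be the class of functions $f$ analytic in $\mathbb{D}$ with $f(0)=0$, $f'(0)=1$ and $f'\neq0$ in $\mathbb{D}$,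 such that $1+zf''(z)/f'(z)$ is subordinate to $\mathcal{T}_{\alpha,\beta,\gamma}$, that is, $$1+\frac{zf''(z)}{f'(z)}=\mathcal{T}_{\alpha,\beta,\gamma}(\omega(z))\qquad(z\in\mathbb{D})$$ for some analytic $\omega:\mathbb{D}\to\mathbb{D}$ with $\omega(0)=0$. If $f\in\mathcal{CV}_{snail}(\alpha,\beta,\gamma)$, then: 1. if $\mathcal{T}_0(\alpha,\beta)\le 1-\dfrac{\beta-\alpha}{2}\le\gamma$, then $$\operatorname{Re} f'(z)>\left(\frac{1+\alpha}{1+\beta}\right)^{\frac{2-2\gamma}{\beta-\alpha}}\qquad(z\in\mathbb{D});$$ 2. $$\operatorname{Re}\left\{f'(z)^{\frac{\beta-\alpha}{2-2\gamma}}\right\}>\frac{1+\alpha}{1+\beta}\qquad(z\in\mathbb{D});$$ 3. $$\left|\operatorname{Arg} f'(z)\right|\le\frac{2(1-\gamma)}{\beta-\alpha}\,\sin^{-1}\left(\frac{|z|(\beta-\alpha)}{1-|z|^2\alpha\beta}\right)\qquad(z\in\mathbb{D}).$$ Here $\operatorname{Arg}$ is the principal argument, with values in $(-\pi,\pi]$,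 and the power in part 2 is the principal one. -/

import Mathlib

namespace PascalSnail

/-- The open unit disc of the complex plane. -/
def unitDisc : Set ℂ := Metric.ball (0 : ℂ) 1

/-- `f` is subordinate to `g` in the unit disc: `f = g ∘ ω` on the disc for some analytic
self-map `ω` of the disc with `ω 0 = 0`. -/
def Subordinate (f g : ℂ → ℂ) : Prop :=
  ∃ ω : ℂ → ℂ, DifferentiableOn ℂ ω unitDisc ∧ Set.MapsTo ω unitDisc unitDisc ∧ ω 0 = 0 ∧
    ∀ z ∈ unitDisc, f z = g (ω z)

/-- The class `𝒜` of functions analytic in the unit disc, `f(z) = z + a₂ z² + a₃ z³ + ⋯`. -/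
def IsNormalizedAnalytic (f : ℂ → ℂ) : Prop :=
  DifferentiableOn ℂ f unitDisc ∧ f 0 = 0 ∧ deriv f 0 = 1

/-- The function `(2 - 2γ) z / ((1 - α z) (1 - β z))`. -/
noncomputable def snailL (α β γ : ℝ) (z : ℂ) : ℂ :=
  (2 - 2 * (γ : ℂ)) * z / ((1 - (α : ℂ) * z) * (1 - (β : ℂ) * z))

/-- The function `1 + (2 - 2γ) z / ((1 - α z) (1 - β z))`, which maps the unit disc onto the
domain bounded by a generalized Pascal snail. -/
noncomputable def snailT (α β γ : ℝ) (z : ℂ) : ℂ := 1 + snailL α β γ z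

/-- The function `β₁` that bounds the region `B₁`. -/
noncomputable def beta1 (α : ℝ) : ℝ :=
  ((1 + α) * √(α ^ 2 + 14 * α + 1) - (α ^ 2 + 6 * α + 1)) / (2 * α * (1 - α))

/-- The region `B₁ = {0 < α < 1, β₁(α) < β < 1}` of parameters. -/
def regionB1 : Set (ℝ × ℝ) :=
  {p | 0 < p.1 ∧ p.1 < 1 ∧ beta1 p.1 < p.2 ∧ p.2 < 1}

open Classical in
/-- The threshold `𝒯₀(α, β)`. -/
noncomputable def snailT0 (α β : ℝ) : ℝ :=
  if (α, β) ∈ regionB1 then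
    1 - (1 - α * β) *
        (2 * √(α * β * (1 - α ^ 2) * (1 - β ^ 2)) + (α + β) * (1 - α * β)) / (1 + α * β) ^ 2
  else 1 - (1 + α) * (1 + β) / 2

/-- The class `𝒞𝒱_snail(α, β, γ)`: normalized analytic `f` with `f' ≠ 0` in the disc and
`1 + z f''(z) / f'(z) ≺ 𝒯_{α,β,γ}(z)`. It is considered for `-1 < α ≤ β < 1`, `0 ≤ γ < 1`,
`𝒯₀(α, β) ≤ γ`. -/
def CVsnail (α β γ : ℝ) : Set (ℂ → ℂ) :=
  {f | IsNormalizedAnalytic f ∧ (∀ z ∈ unitDisc, deriv f z ≠ 0) ∧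
    Subordinate (fun z => 1 + z * deriv (deriv f) z / deriv f z) (snailT α β γ)}

end PascalSnail

/-! Put `c = (2 - 2γ)/(β - α)` and let `u` be the branch of `(f')^(1/c)` with `u(0) = 1`. The
subordination becomes `z u'/u = (β - α) φ(ω)` with `φ(x) = x/((1 - αx)(1 - βx))`, and the Möbius map
`q(x) = (1 - αx)/(1 - βx)` satisfies `x q'/q = (β - α) φ(x)`. Since `φ` is starlike, Jack's lemma
forces `u = q ∘ W` with `W` a Schwarz function: where `|W|` first reaches 1, `φ(ω) = m φ(W)` with `m
≥ 1`, which no `ω` in the disc satisfies (`exists_moebius_of_starlike`).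

Hence, for `|z| ≤ r < 1`, `u(z)` lies in the disc `q(|w| ≤ r)`, which bounds `Re u` and `arg u`
(`moebius_re_arg`). The threshold on `γ` gives `c |arg u| < π`, so `Log f' = c Log u` for principal
logarithms. Parts 2 and 3 follow at once; part 1 uses `Re u^c ≥ (Re u)^c` for `c ≤ 1`. -/

namespace PascalSnail

open Complex ComplexConjugate Topology Filter Metric

/-! ### Starlikeness of `φ` and Jack's lemma -/

/-- The map `x + iy ↦ 1 / (x + iy) + P (x + iy)` sends points of the open unit disc outside the
ellipse that is the image of the unit circle. -/
lemma false_of_ellipse {m q P S a b x y : ℝ} (hq : q = x * x + y * y) (hq0 : 0 < q) (hq1 : q < 1)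
    (hP1 : 0 < 1 + P) (hP2 : 0 < 1 - P) (hm : 1 ≤ m) (hab : a * a + b * b = 1)
    (hSabs : |S| ≤ 1 + P)
    (hA : m * (x * (1 + P * q)) = q * (a * (1 + P) + (m - 1) * S))
    (hB : m * (y * (1 - P * q)) = q * (b * (1 - P))) : False := by
  have hm0 : 0 < m := by linarith
  have hPsq : P ^ 2 < 1 := by nlinarith
  have hpos : 0 < (1 - q) * (1 - P ^ 2 * q) := mul_pos (by linarith) (by nlinarith [sq_nonneg P])
  -- `1/w + Pw` lies strictly outside the ellipse with semi-axes `1 + P`, `1 - P`.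
  have hlow : q ^ 2 * ((1 + P) ^ 2 * (1 - P) ^ 2) <
      (1 - P) ^ 2 * (x * (1 + P * q)) ^ 2 + (1 + P) ^ 2 * (y * (1 - P * q)) ^ 2 := by
    have e : (1 - P) ^ 2 * (x * (1 + P * q)) ^ 2 + (1 + P) ^ 2 * (y * (1 - P * q)) ^ 2
        = q ^ 2 * ((1 + P) ^ 2 * (1 - P) ^ 2)
          + (1 - q) * (1 - P ^ 2 * q) * ((1 - P) ^ 2 * (x * x) + (1 + P) ^ 2 * (y * y)) := by
      have : q ^ 2 = q * (x * x + y * y) := by rw [← hq]; ring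
      rw [this]
      ring
    rw [e]
    have h3 : 0 < (1 - P) ^ 2 * (x * x) + (1 + P) ^ 2 * (y * y) := by
      have hx := mul_self_nonneg x
      have hy := mul_self_nonneg y
      rcases hx.eq_or_lt with hx | hx
      · have : 0 < y * y := by linarith
        positivity
      · positivity
    have := mul_pos hpos h3
    linarith
  have haS : a * S ≤ 1 + P := by
    have h2 : |a| ≤ 1 := abs_le_of_sq_le_sq (by nlinarith [mul_self_nonneg b]) zero_le_one
    calc a * S ≤ |a * S| := le_abs_self _
      _ = |a| * |S| := abs_mul _ _
      _ ≤ 1 * (1 + P) := by gcongr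
      _ = 1 + P := one_mul _
  have hSsq : S ^ 2 ≤ (1 + P) ^ 2 := sq_le_sq.2 (by rwa [abs_of_pos hP1])
  -- By `hA` and `hB` the same point is, up to conjugation, a convex combination, with weights `1/m`
  -- and `1 - 1/m`, of a point of the ellipse and of `S`, hence not outside. The ellipse is
  -- stretched here to a circle.
  have hup : (a * (1 + P) + (m - 1) * S) ^ 2 + (b * (1 + P)) ^ 2 ≤ m ^ 2 * (1 + P) ^ 2 := by
    have h1 := mul_le_mul_of_nonneg_left hSsq (sq_nonneg (m - 1))
    have h2 := mul_le_mul_of_nonneg_left haS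
      (show 0 ≤ 2 * (m - 1) * (1 + P) from mul_nonneg (by linarith) hP1.le)
    have h3 : (a * a + b * b) * (1 + P) ^ 2 = (1 + P) ^ 2 := by rw [hab, one_mul]
    linarith
  have h5 := mul_lt_mul_of_pos_left hlow (pow_pos hm0 2)
  have h6 := mul_le_mul_of_nonneg_left hup (show 0 ≤ q ^ 2 * (1 - P) ^ 2 by positivity)
  have h7 : m ^ 2 * ((1 - P) ^ 2 * (x * (1 + P * q)) ^ 2 + (1 + P) ^ 2 * (y * (1 - P * q)) ^ 2)
      = q ^ 2 * (1 - P) ^ 2 * ((a * (1 + P) + (m - 1) * S) ^ 2 + (b * (1 + P)) ^ 2) := by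
    have eA := congrArg (fun t => (1 - P) ^ 2 * t ^ 2) hA
    have eB := congrArg (fun t => (1 + P) ^ 2 * t ^ 2) hB
    simp only [mul_pow] at eA eB ⊢
    linarith
  linarith

/-- For the starlike function `φ(x) = x / ((1 - αx)(1 - βx))`, if `φ(w) = m φ(W)` with `m ≥ 1` and
`W` on the unit circle, then `w` is not in the open unit disc. -/
lemma one_le_norm_of_starlike_relation {α β m : ℝ} (hα : |α| < 1) (hβ : |β| < 1) (hm : 1 ≤ m)
    {W w : ℂ} (hW : ‖W‖ = 1)
    (h : m * W * ((1 - α * w) * (1 - β * w)) = w * ((1 - α * W) * (1 - β * W))) :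
    1 ≤ ‖w‖ := by
  by_contra! hw
  have hm0 : (0 : ℝ) < m := by linarith
  have hW0 : W ≠ 0 := by
    rintro rfl
    simp at hW
  have hw0 : w ≠ 0 := by
    rintro rfl
    have h1 : (m : ℂ) * W = 0 := by simpa using h
    exact mul_ne_zero (by exact_mod_cast hm0.ne') hW0 h1
  obtain ⟨hα1, hα2⟩ := abs_lt.1 hα
  obtain ⟨hβ1, hβ2⟩ := abs_lt.1 hβ
  have hP1 : 0 < 1 + α * β := by nlinarith
  have hP2 : 0 < 1 - α * β := by nlinarith
  obtain ⟨x, y⟩ := w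
  obtain ⟨a, b⟩ := W
  have hab : a * a + b * b = 1 := by
    have := Complex.sq_norm (⟨a, b⟩ : ℂ)
    rw [hW, Complex.normSq_mk] at this
    linarith
  have hq1 : x * x + y * y < 1 := by
    have := Complex.sq_norm (⟨x, y⟩ : ℂ)
    rw [Complex.normSq_mk] at this
    nlinarith [norm_nonneg (⟨x, y⟩ : ℂ)]
  have hq0 : 0 < x * x + y * y := by
    have := Complex.normSq_pos.2 hw0
    rwa [Complex.normSq_mk] at this
  -- The reciprocal relation `m/φ(w) = 1/φ(W)` times `|w|²`, where `1/φ(w) = 1/w - (α + β) + αβ w`.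
  have key : (m : ℂ) * ((⟨x, -y⟩ : ℂ) - (α + β) * (x * x + y * y : ℝ)
      + α * β * (x * x + y * y : ℝ) * ⟨x, y⟩)
      = (x * x + y * y : ℝ) * (⟨a, -b⟩ - (α + β) + α * β * ⟨a, b⟩) := by
    have e1 : (⟨x, -y⟩ : ℂ) * ⟨x, y⟩ = (x * x + y * y : ℝ) := by
      apply Complex.ext <;> simp <;> ring
    have e2 : (⟨a, -b⟩ : ℂ) * ⟨a, b⟩ = 1 := by
      apply Complex.ext <;> simp <;> linarith
    rw [← e1]
    linear_combination ((⟨x, -y⟩ : ℂ) * ⟨a, -b⟩) * h +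
      (m * ⟨x, -y⟩ * (- (1 - α * ⟨x, y⟩) * (1 - β * ⟨x, y⟩))
       + (⟨x, -y⟩ : ℂ) * ⟨x, y⟩ * (- (α + β) + α * β * ⟨a, b⟩)) * e2
  have kre := congrArg Complex.re key
  have kim := congrArg Complex.im key
  simp only [mul_re, mul_im, add_re, add_im, sub_re, sub_im, ofReal_re, ofReal_im] at kre kim
  have hS : |α + β| ≤ 1 + α * β := abs_le.2 ⟨by nlinarith, by nlinarith⟩
  exact false_of_ellipse rfl hq0 hq1 hP1 hP2 hm hab hS (by linear_combination kre)
    (by linear_combination -kim)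

/-- **Jack's lemma**. -/
lemma exists_mul_deriv_eq_of_norm_eq_one {W : ℂ → ℂ} {z₀ : ℂ} (hz₀ : z₀ ≠ 0)
    (hd : DifferentiableOn ℂ W (ball 0 ‖z₀‖)) (hd₀ : DifferentiableAt ℂ W z₀) (h0 : W 0 = 0)
    (hlt : ∀ z, ‖z‖ < ‖z₀‖ → ‖W z‖ ≤ 1) (hle : ∀ z, ‖z‖ = ‖z₀‖ → ‖W z‖ ≤ 1)
    (h1 : ‖W z₀‖ = 1) : ∃ m : ℝ, 1 ≤ m ∧ z₀ * deriv W z₀ = m * W z₀ := by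
  have hr : 0 < ‖z₀‖ := norm_pos_iff.2 hz₀
  set X : ℂ := z₀ * deriv W z₀ * conj (W z₀) with hX
  -- Along the circle through `z₀`, `|W|²` is maximal at `z₀`.
  have him : X.im = 0 := by
    have hγ : HasDerivAt (fun t : ℝ => z₀ * Complex.exp (t * I)) (z₀ * I) 0 := by
      have h2 : HasDerivAt (fun t : ℝ => (t : ℂ) * I) (1 * I) 0 :=
        (HasDerivAt.ofReal_comp (hasDerivAt_id (0 : ℝ))).mul_const I
      have := (h2.cexp).const_mul z₀
      simpa using this
    have hW : HasDerivAt (fun t : ℝ => W (z₀ * Complex.exp (t * I)))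
        (deriv W z₀ * (z₀ * I)) 0 := by
      have h3 : HasDerivAt W (deriv W z₀) (z₀ * Complex.exp ((0 : ℝ) * I)) := by
        simpa using hd₀.hasDerivAt
      exact h3.comp (0 : ℝ) hγ
    have hn := hW.norm_sq
    have hmax : IsLocalMax (fun t : ℝ => ‖W (z₀ * Complex.exp (t * I))‖ ^ 2) 0 := by
      refine Filter.Eventually.of_forall fun t => ?_
      have := hle (z₀ * Complex.exp (t * I)) (by simp [Complex.norm_exp_ofReal_mul_I])
      simp only [ofReal_zero, zero_mul, Complex.exp_zero, mul_one, h1]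
      gcongr
    have h4 := hmax.hasDerivAt_eq_zero hn
    rw [Complex.inner] at h4
    have h5 : deriv W z₀ * (z₀ * I) * conj (W z₀) = X * I := by rw [hX]; ring
    simp only [ofReal_zero, zero_mul, Complex.exp_zero, mul_one, h5] at h4
    simpa using h4
  -- By the Schwarz lemma `|W(t z₀)|² - t² ≤ 0` for `0 < t < 1`, with equality at `t = 1`, so the
  -- derivative `2 Re X - 2` there is nonnegative.
  have hre : 1 ≤ X.re := by
    have hγ : HasDerivAt (fun t : ℝ => (t : ℂ) * z₀) z₀ 1 := by
      simpa using (HasDerivAt.ofReal_comp (hasDerivAt_id (1 : ℝ))).mul_const z₀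
    have hW : HasDerivAt (fun t : ℝ => W ((t : ℂ) * z₀)) (deriv W z₀ * z₀) 1 := by
      have h3 : HasDerivAt W (deriv W z₀) (((1 : ℝ) : ℂ) * z₀) := by
        simpa using hd₀.hasDerivAt
      exact h3.comp (1 : ℝ) hγ
    have hn := hW.norm_sq.sub (hasDerivAt_pow 2 (1 : ℝ))
    have h4 := (hasDerivWithinAt_iff_tendsto_slope' (s := Set.Iio (1 : ℝ)) Set.self_notMem_Iio).1
      hn.hasDerivWithinAt
    have h5 : ∀ᶠ t in 𝓝[<] (1 : ℝ), (0 : ℝ) ≤ slope ((fun t : ℝ => ‖W ((t : ℂ) * z₀)‖ ^ 2) - fun t => t ^ 2) 1 t := by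
      filter_upwards [Ioo_mem_nhdsLT (zero_lt_one' ℝ)] with t ht
      have hS : ‖W (t * z₀)‖ ≤ t := by
        have hb : ‖(t : ℂ) * z₀‖ < ‖z₀‖ := by
          rw [norm_mul, Complex.norm_real, Real.norm_of_nonneg ht.1.le]
          exact mul_lt_of_lt_one_left hr ht.2
        have := Complex.dist_le_div_mul_dist_of_mapsTo_ball (R₂ := 1) hd
          (fun z hz => by simpa [h0] using hlt z (by simpa using hz)) (z := t * z₀)
          (by simpa using hb)
        simpa [h0, abs_of_pos ht.1, hr.ne', mul_comm, mul_assoc] using this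
      rw [slope_def_field]
      refine div_nonneg_of_nonpos ?_ (sub_nonpos.2 ht.2.le)
      simp only [Pi.sub_apply, ofReal_one, one_mul, h1]
      have : ‖W (t * z₀)‖ ^ 2 ≤ t ^ 2 := by gcongr
      linarith
    have h6 := ge_of_tendsto h4 h5
    rw [Complex.inner] at h6
    have h7 : deriv W z₀ * z₀ * conj (W z₀) = X := by rw [hX]; ring
    simp only [ofReal_one, one_mul, h7] at h6
    norm_num at h6
    linarith
  refine ⟨X.re, hre, ?_⟩
  have hXr : (X.re : ℂ) = X := by apply Complex.ext <;> simp [him]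
  rw [hXr, hX]
  have h8 : conj (W z₀) * W z₀ = 1 := by
    rw [mul_comm, Complex.mul_conj, ← Complex.sq_norm, h1]; simp
  linear_combination (-(z₀ * deriv W z₀)) * h8

/-! ### Analytic logarithm and subordination to the Möbius map -/

/-- A zero-free analytic function on the unit disc has an analytic logarithm. -/
lemma exists_analytic_log {p : ℂ → ℂ} (hp : DifferentiableOn ℂ p (ball 0 1))
    (hne : ∀ z ∈ ball (0 : ℂ) 1, p z ≠ 0) (h0 : p 0 = 1) :
    ∃ g : ℂ → ℂ, g 0 = 0 ∧ ∀ z ∈ ball (0 : ℂ) 1,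
      HasDerivAt g (deriv p z / p z) z ∧ p z = Complex.exp (g z) := by
  have hdp : DifferentiableOn ℂ (fun z => deriv p z / p z) (ball 0 1) :=
    (hp.deriv isOpen_ball).div hp hne
  obtain ⟨g, hg⟩ := hdp.isExactOn_ball.with_val_at 0 0
  have hd : ∀ z ∈ ball (0 : ℂ) 1, HasDerivAt (fun z => p z * Complex.exp (-g z)) 0 z := by
    intro z hz
    have h1 := (hp.differentiableAt (isOpen_ball.mem_nhds hz)).hasDerivAt
    have h2 : HasDerivAt (fun z => p z * Complex.exp (-g z)) (deriv p z * Complex.exp (-g z) +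
        p z * (Complex.exp (-g z) * -(deriv p z / p z))) z := h1.mul (hg.2 z hz).fun_neg.cexp
    refine h2.congr_deriv ?_
    field_simp [hne z hz]
    ring
  refine ⟨g, hg.1, fun z hz => ⟨hg.2 z hz, ?_⟩⟩
  have hc : p z * Complex.exp (-g z) = p 0 * Complex.exp (-g 0) :=
    isOpen_ball.is_const_of_deriv_eq_zero (convex_ball (0 : ℂ) 1).isPreconnected
      (f := fun z => p z * Complex.exp (-g z))
      (fun z hz => (hd z hz).differentiableAt.differentiableWithinAt)
      (fun z hz => (hd z hz).deriv) hz (by simp)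
  rw [h0, hg.1, neg_zero, Complex.exp_zero, mul_one, Complex.exp_neg] at hc
  exact (div_eq_one_iff_eq (Complex.exp_ne_zero _)).1 hc

/-- Explicit form of the subordination principle for the convex function
`log ((1 - αz) / (1 - βz))`. -/
lemma exists_moebius_of_starlike {α β : ℝ} (hα : -1 < α) (hαβ : α < β) (hβ : β < 1)
    {u ω : ℂ → ℂ} (hu : DifferentiableOn ℂ u (ball 0 1)) (h0 : u 0 = 1)
    (hω : ∀ z ∈ ball (0 : ℂ) 1, ‖ω z‖ < 1)
    (h : ∀ z ∈ ball (0 : ℂ) 1,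
      z * deriv u z * ((1 - α * ω z) * (1 - β * ω z)) = (β - α) * ω z * u z) :
    ∀ z ∈ ball (0 : ℂ) 1, ∃ w : ℂ, ‖w‖ ≤ ‖z‖ ∧ u z * (1 - β * w) = 1 - α * w := by
  have hβα : (β : ℂ) - α ≠ 0 := by
    rw [← ofReal_sub]; exact_mod_cast (sub_pos.2 hαβ).ne'
  set W : ℂ → ℂ := fun z => (u z - 1) / (β * u z - α) with hWdef
  -- `W` may a priori have poles, so `|W| ≤ 1` is expressed by this inequality of norms, which
  -- excludes them.
  have hne : ∀ z, ‖u z - 1‖ ≤ ‖β * u z - α‖ → β * u z - α ≠ 0 := by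
    intro z hz h1
    rw [h1, norm_zero, norm_le_zero_iff] at hz
    rw [sub_eq_zero.1 hz, mul_one] at h1
    exact hβα h1
  have hWle : ∀ z, ‖u z - 1‖ ≤ ‖β * u z - α‖ → ‖W z‖ ≤ 1 := by
    intro z hz
    simp only [hWdef, norm_div]
    exact div_le_one_of_le₀ hz (norm_nonneg _)
  have hW0 : W 0 = 0 := by simp [hWdef, h0]
  have hWd : ∀ z ∈ ball (0 : ℂ) 1, ‖u z - 1‖ ≤ ‖β * u z - α‖ → HasDerivAt W
      ((deriv u z * (β * u z - α) - (u z - 1) * (β * deriv u z)) / (β * u z - α) ^ 2) z := by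
    intro z hz hz1
    have hud := (hu.differentiableAt (isOpen_ball.mem_nhds hz)).hasDerivAt
    exact (hud.sub_const 1).div ((hud.const_mul (β : ℂ)).sub_const _) (hne z hz1)
  have hlt : ∀ z ∈ ball (0 : ℂ) 1, ‖u z - 1‖ < ‖β * u z - α‖ := by
    by_contra! hbad
    obtain ⟨z₁, hz₁, hbad⟩ := hbad
    have hz₁' : ‖z₁‖ < 1 := by simpa using hz₁
    have hsub : closedBall (0 : ℂ) ‖z₁‖ ⊆ ball 0 1 := closedBall_subset_ball hz₁'
    have hcl : IsCompact {z ∈ closedBall (0 : ℂ) ‖z₁‖ | ‖β * u z - α‖ ≤ ‖u z - 1‖} := by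
      have huc := hu.continuousOn.mono hsub
      refine (isCompact_closedBall _ _).of_isClosed_subset ?_ (Set.sep_subset _ _)
      exact isClosed_closedBall.isClosed_le (by fun_prop) (by fun_prop)
    -- A point of least modulus where `|W| < 1` fails.
    obtain ⟨z₀, ⟨hz₀b, hz₀⟩, hmin⟩ := hcl.exists_isMinOn ⟨z₁, by simp, hbad⟩
      continuous_norm.continuousOn
    have hz₀z₁ : ‖z₀‖ ≤ ‖z₁‖ := by simpa using hz₀b
    have hz₀1 : z₀ ∈ ball (0 : ℂ) 1 := hsub hz₀b
    have hin : ∀ z, ‖z‖ < ‖z₀‖ → ‖u z - 1‖ < ‖β * u z - α‖ := by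
      intro z hz
      by_contra! hz2
      exact absurd (hmin (a := z) ⟨by simpa using hz.le.trans hz₀z₁, hz2⟩) (not_le.2 hz)
    have hz₀0 : z₀ ≠ 0 := by
      rintro rfl
      rw [h0, mul_one, sub_self, norm_zero, norm_le_zero_iff] at hz₀
      exact hβα hz₀
    have hcirc : ∀ z, ‖z‖ ≤ ‖z₀‖ → ‖u z - 1‖ ≤ ‖β * u z - α‖ := by
      intro z hz
      have hcb : closure (ball (0 : ℂ) ‖z₀‖) = closedBall 0 ‖z₀‖ :=
        closure_ball _ (norm_ne_zero_iff.2 hz₀0)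
      have huc : ContinuousOn u (closure (ball (0 : ℂ) ‖z₀‖)) := by
        rw [hcb]
        exact hu.continuousOn.mono ((closedBall_subset_closedBall hz₀z₁).trans hsub)
      refine le_on_closure (f := fun z => ‖u z - 1‖) (g := fun z => ‖β * u z - α‖)
        (s := ball (0 : ℂ) ‖z₀‖) (fun z hz => (hin z (by simpa using hz)).le)
        (by fun_prop) (by fun_prop) ?_
      rw [hcb]; simpa using hz
    have hE := hcirc z₀ le_rfl
    have hD := hWd z₀ hz₀1 hE
    have hD0 := hne z₀ hE
    have hW1 : ‖W z₀‖ = 1 := by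
      simp only [hWdef, norm_div]
      rw [le_antisymm hE hz₀, div_self (norm_ne_zero_iff.2 hD0)]
    obtain ⟨m, hm, hmW⟩ := exists_mul_deriv_eq_of_norm_eq_one hz₀0
      (fun z hz => (hWd z (ball_subset_ball (by simpa using (mem_ball_zero_iff.1 hz₀1).le) hz)
        (hin z (by simpa using hz)).le).differentiableAt.differentiableWithinAt)
      hD.differentiableAt hW0 (fun z hz => hWle z (hcirc z hz.le))
      (fun z hz => hWle z (hcirc z hz.le)) hW1
    rw [hD.deriv] at hmW
    have hrel := one_le_norm_of_starlike_relation (w := ω z₀) (abs_lt.2 ⟨hα, by linarith⟩)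
      (abs_lt.2 ⟨by linarith, hβ⟩) hm hW1 (by
        have hh := h z₀ hz₀1
        rw [← hmW]
        simp only [hWdef]
        field_simp
        linear_combination ((β : ℂ) - α) * hh)
    exact absurd (hω z₀ hz₀1) (not_lt.2 hrel)
  intro z hz
  refine ⟨W z, ?_, ?_⟩
  · refine Complex.norm_le_norm_of_mapsTo_ball (R := 1) (f := W)
      (fun z hz => (hWd z hz (hlt z hz).le).differentiableAt.differentiableWithinAt)
      (fun z hz => by simpa using hWle z (hlt z hz).le) hW0 (by simpa using hz)
  · have hW : W z * (β * u z - α) = u z - 1 := div_mul_cancel₀ _ (hne z (hlt z hz).le)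
    linear_combination -hW

/-! ### What the threshold gives: principal branches -/

/-- The only property of the threshold that the proof needs; it keeps `c arg u` inside `(-π, π)`. -/
lemma one_sub_snailT0_le {α β : ℝ} (hα : -1 < α) (hαβ : α < β) (hβ : β < 1) :
    1 - snailT0 α β ≤ 1 - α * β := by
  have hP1 : 0 < 1 + α * β := by nlinarith
  have hP2 : 0 < 1 - α * β := by nlinarith
  unfold snailT0
  split_ifs with h
  · obtain ⟨h1, -, -, -⟩ := h
    dsimp only at h1
    have hP0 : 0 < α * β := mul_pos h1 (h1.trans hαβ)
    have hv : 0 ≤ (1 - α ^ 2) * (1 - β ^ 2) := mul_nonneg (by nlinarith) (by nlinarith)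
    set s := √(α * β * (1 - α ^ 2) * (1 - β ^ 2)) with hs
    have hs2 : s ^ 2 = α * β * ((1 - α ^ 2) * (1 - β ^ 2)) := by
      rw [hs, Real.sq_sqrt (by rw [mul_assoc]; positivity)]
      ring
    have key : 2 * s + (α + β) * (1 - α * β) ≤ (1 + α * β) ^ 2 := by
      set k := √(α * β)
      have hk2 : k ^ 2 = α * β := Real.sq_sqrt hP0.le
      set v := √((1 - α ^ 2) * (1 - β ^ 2))
      have hv2 : v ^ 2 = (1 - α ^ 2) * (1 - β ^ 2) := Real.sq_sqrt hv
      have hskv : s = k * v := by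
        rw [hs, mul_assoc, Real.sqrt_mul hP0.le]
      rw [hskv]
      have e1 : v ^ 2 + (α + β) ^ 2 = (1 + α * β) ^ 2 := by rw [hv2]; ring
      have e2 : 4 * k ^ 2 + (1 - α * β) ^ 2 = (1 + α * β) ^ 2 := by rw [hk2]; ring
      -- Cauchy–Schwarz, as Lagrange's identity, for the vectors `(2k, 1 - αβ)` and `(v, α + β)`,
      -- both of length `1 + αβ`.
      have e3 : (2 * (k * v) + (α + β) * (1 - α * β)) ^ 2 +
          (2 * k * (α + β) - (1 - α * β) * v) ^ 2 = ((1 + α * β) ^ 2) ^ 2 := by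
        calc _ = (4 * k ^ 2 + (1 - α * β) ^ 2) * (v ^ 2 + (α + β) ^ 2) := by ring
          _ = _ := by rw [e1, e2]; ring
      refine (abs_le.1 (abs_le_of_sq_le_sq ?_ (by positivity))).2
      linarith [sq_nonneg (2 * k * (α + β) - (1 - α * β) * v)]
    have : (1 - α * β) * (2 * s + (α + β) * (1 - α * β)) / (1 + α * β) ^ 2 ≤ 1 - α * β := by
      rw [div_le_iff₀ (by positivity)]
      exact mul_le_mul_of_nonneg_left key hP2.le
    linarith
  · suffices 3 * α * β + α + β ≤ 1 by nlinarith
    rcases le_or_gt α 0 with h0 | h0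
    · nlinarith [mul_nonneg (neg_nonneg.2 h0) (by linarith : (0 : ℝ) ≤ 1 + β)]
    · have hb1 : β ≤ beta1 α := by
        by_contra! hb
        exact h ⟨h0, by simpa using hαβ.trans hβ, hb, hβ⟩
      have ha1 : α < 1 := hαβ.trans hβ
      by_contra! hc
      -- The squares differ by `16 α² (1 - α)²`. This bound yields `β₁(α) ≤ (1 - α)/(1 + 3α)`, the
      -- value of `β` at which `3αβ + α + β = 1`.
      have hsq : √(α ^ 2 + 14 * α + 1) * (1 + 3 * α) ≤ 5 * α ^ 2 + 10 * α + 1 := by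
        rw [← le_div_iff₀ (by positivity), Real.sqrt_le_left (by positivity), div_pow,
          le_div_iff₀ (by positivity)]
        nlinarith [sq_nonneg (α * (1 - α))]
      rw [beta1, le_div_iff₀ (by nlinarith)] at hb1
      have h2 : (1 - α) < β * (1 + 3 * α) := by linarith
      have h3 := mul_lt_mul_of_pos_left h2 (show 0 < 2 * α * (1 - α) by nlinarith)
      have h4 := mul_le_mul_of_nonneg_left hsq (show 0 ≤ 1 + α by linarith)
      have h5 := mul_le_mul_of_nonneg_right hb1 (show 0 ≤ 1 + 3 * α by linarith)
      nlinarith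

lemma arcsin_le_pi_div_two_mul {s : ℝ} (h0 : 0 ≤ s) (h1 : s ≤ 1) :
    Real.arcsin s ≤ Real.pi / 2 * s := by
  have h := Real.mul_le_sin (Real.arcsin_nonneg.2 h0) (Real.arcsin_le_pi_div_two s)
  rw [Real.sin_arcsin (by linarith) h1, div_mul_eq_mul_div, div_le_iff₀ Real.pi_pos] at h
  linarith

lemma div_one_sub_sq_mul_lt {α β r : ℝ} (hα : -1 < α) (hαβ : α < β) (hβ : β < 1)
    (hr0 : 0 ≤ r) (hr1 : r < 1) :
    0 ≤ r * (β - α) / (1 - r ^ 2 * (α * β)) ∧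
      r * (β - α) / (1 - r ^ 2 * (α * β)) < (β - α) / (1 - α * β) := by
  have hP1 : 0 < 1 + α * β := by nlinarith
  have hP2 : 0 < 1 - α * β := by nlinarith
  have hr2 : r ^ 2 < 1 := by nlinarith
  have hD : 0 < 1 - r ^ 2 * (α * β) := by nlinarith [sq_nonneg r]
  refine ⟨div_nonneg (mul_nonneg hr0 (by linarith)) hD.le, ?_⟩
  rw [div_lt_div_iff₀ hD hP2]
  have h1 : 0 < (1 - r) * (1 + r * (α * β)) := mul_pos (by linarith) (by nlinarith)
  nlinarith [mul_pos (sub_pos.2 hαβ) h1]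

lemma mul_arcsin_lt_pi {α β γ r : ℝ} (hα : -1 < α) (hαβ : α < β) (hβ : β < 1)
    (hγ1 : γ < 1) (hγT : snailT0 α β ≤ γ) (hr0 : 0 ≤ r) (hr1 : r < 1) :
    (2 - 2 * γ) / (β - α) * Real.arcsin (r * (β - α) / (1 - r ^ 2 * (α * β))) < Real.pi := by
  have hP2 : 0 < 1 - α * β := by nlinarith
  have hc : 0 < (2 - 2 * γ) / (β - α) := div_pos (by linarith) (by linarith)
  obtain ⟨h0, h1⟩ := div_one_sub_sq_mul_lt hα hαβ hβ hr0 hr1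
  have h2 : (β - α) / (1 - α * β) ≤ 1 := by
    rw [div_le_one hP2]
    nlinarith
  have hγ := (sub_le_sub_left hγT 1).trans (one_sub_snailT0_le hα hαβ hβ)
  -- Jordan's inequality at the limiting radius `r = 1`; the factor `β - α` cancels.
  calc _ < (2 - 2 * γ) / (β - α) * (Real.pi / 2 * ((β - α) / (1 - α * β))) := by
        refine mul_lt_mul_of_pos_left ?_ hc
        exact (arcsin_le_pi_div_two_mul h0 (h1.le.trans h2)).trans_lt
          (mul_lt_mul_of_pos_left h1 (by positivity))
    _ = Real.pi * ((1 - γ) / (1 - α * β)) := by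
        have : β - α ≠ 0 := by linarith
        field_simp
    _ ≤ Real.pi * 1 := by
        gcongr
        rwa [div_le_one hP2]
    _ = Real.pi := mul_one _

/-! ### Geometry of the image disc and real parts of powers -/

/-- Real part and argument of `u = (1 - αw) / (1 - βw)` for `‖w‖ ≤ r`. -/
lemma moebius_re_arg {α β r : ℝ} (hα : -1 < α) (hαβ : α < β) (hβ : β < 1)
    (hr1 : r < 1) {u w : ℂ} (hw : ‖w‖ ≤ r) (h : u * (1 - β * w) = 1 - α * w) :
    (1 + α) / (1 + β) < u.re ∧
      |u.arg| ≤ Real.arcsin (r * (β - α) / (1 - r ^ 2 * (α * β))) := by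
  have hr0 : 0 ≤ r := (norm_nonneg w).trans hw
  have hP1 : 0 < 1 + α * β := by nlinarith
  have hP2 : 0 < 1 - α * β := by nlinarith
  have hr2 : r ^ 2 < 1 := by nlinarith
  have hD : 0 < 1 - r ^ 2 * (α * β) := by nlinarith [sq_nonneg r]
  have hE : 0 < 1 - r ^ 2 * β ^ 2 := by nlinarith [sq_nonneg r, sq_nonneg β]
  have hF : 0 < 1 - r ^ 2 * α ^ 2 := by nlinarith [sq_nonneg r, sq_nonneg α]
  have h1 : u - 1 = w * (β * u - α) := by linear_combination h
  have hne : (β : ℂ) * u - α ≠ 0 := by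
    intro h0
    rw [h0, mul_zero, sub_eq_zero] at h1
    rw [h1, mul_one, sub_eq_zero] at h0
    exact hαβ.ne' (by exact_mod_cast h0)
  have h2 : ‖u - 1‖ ^ 2 ≤ r ^ 2 * ‖(β : ℂ) * u - α‖ ^ 2 := by
    rw [h1, norm_mul, mul_pow]
    gcongr
  have hpos : 0 < ‖(β : ℂ) * u - α‖ ^ 2 := by positivity
  have hN : ‖u‖ ^ 2 = u.re * u.re + u.im * u.im := by
    rw [Complex.sq_norm, Complex.normSq_apply]
  rw [Complex.sq_norm, Complex.normSq_apply] at hpos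
  rw [Complex.sq_norm, Complex.sq_norm, Complex.normSq_apply, Complex.normSq_apply] at h2
  simp only [sub_re, sub_im, mul_re, mul_im, ofReal_re, ofReal_im, one_re, one_im, zero_mul,
    sub_zero, add_zero] at h2 hpos
  have hx : (1 + α) / (1 + β) < u.re := by
    rw [div_lt_iff₀ (by linarith)]
    by_contra! hx
    have h3 : u.re * (1 - β) ≤ 1 - α := by
      have : u.re ≤ 1 := by nlinarith
      nlinarith
    -- This product is `(Re u - 1)² - (β Re u - α)²`; with `h6` it gives `|u - 1| ≥ |βu - α|`,
    -- against `h2` and `r < 1`.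
    have h4 : 0 ≤ (1 - α - u.re * (1 - β)) * (1 + α - u.re * (1 + β)) :=
      mul_nonneg (by linarith) (by linarith)
    have h5 := mul_lt_mul_of_pos_right hr2 hpos
    have h6 : 0 ≤ (1 - β ^ 2) * (u.im * u.im) :=
      mul_nonneg (by nlinarith) (mul_self_nonneg _)
    nlinarith
  refine ⟨hx, ?_⟩
  have hx0 : 0 < u.re := (div_pos (by linarith) (by linarith)).trans hx
  have hu0 : 0 < ‖u‖ := norm_pos_iff.2 (by rintro rfl; simp at hx0)
  obtain ⟨hs0, -⟩ := div_one_sub_sq_mul_lt hα hαβ hβ hr0 hr1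
  set N := u.re * u.re + u.im * u.im with hNdef
  have h3 : (1 - r ^ 2 * β ^ 2) * N + (1 - r ^ 2 * α ^ 2) ≤ 2 * u.re * (1 - r ^ 2 * (α * β)) := by
    rw [hNdef]
    linarith
  have hN0 : 0 ≤ N := add_nonneg (mul_self_nonneg _) (mul_self_nonneg _)
  have h4 : ((1 - r ^ 2 * β ^ 2) * N + (1 - r ^ 2 * α ^ 2)) ^ 2 ≤
      (2 * u.re * (1 - r ^ 2 * (α * β))) ^ 2 := by
    gcongr
  -- AM-GM on the left of `h3`, with `(1 - r²α²)(1 - r²β²) = (1 - r²αβ)² - r²(β - α)²`. The result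
  -- bounds `|sin (arg u)|`.
  have h5 : (u.im * (1 - r ^ 2 * (α * β))) ^ 2 ≤ (r * (β - α)) ^ 2 * N := by
    have h6 := sq_nonneg ((1 - r ^ 2 * β ^ 2) * N - (1 - r ^ 2 * α ^ 2))
    have h7 : (u.im * (1 - r ^ 2 * (α * β))) ^ 2 =
      N * (1 - r ^ 2 * (α * β)) ^ 2 - (u.re * (1 - r ^ 2 * (α * β))) ^ 2 := by
      rw [hNdef]; ring
    rw [h7]
    linarith
  have h6 : |u.im / ‖u‖| ≤ r * (β - α) / (1 - r ^ 2 * (α * β)) := by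
    refine abs_le_of_sq_le_sq ?_ hs0
    rw [div_pow, div_pow, div_le_div_iff₀ (by positivity) (by positivity), hN, ← mul_pow]
    exact h5
  rw [Complex.arg_of_re_nonneg hx0.le]
  obtain ⟨h7, h8⟩ := abs_le.1 h6
  refine abs_le.2 ⟨?_, Real.monotone_arcsin h8⟩
  rw [← Real.arcsin_neg]
  exact Real.monotone_arcsin h7

/-- Both sides are separated by `c cos θ + (1 - c)`: weighted AM-GM below, concavity of cosine
above. -/
lemma cos_rpow_le_cos_mul {c θ : ℝ} (hc0 : 0 ≤ c) (hc1 : c ≤ 1) (hθ : |θ| ≤ Real.pi / 2) :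
    Real.cos θ ^ c ≤ Real.cos (c * θ) := by
  have hmem : θ ∈ Set.Icc (-(Real.pi / 2)) (Real.pi / 2) := abs_le.1 hθ
  have hcos : 0 ≤ Real.cos θ := Real.cos_nonneg_of_mem_Icc hmem
  have h1 := Real.geom_mean_le_arith_mean2_weighted hc0 (sub_nonneg.2 hc1) hcos zero_le_one
    (by ring)
  have h2 := strictConcaveOn_cos_Icc.concaveOn.2 hmem
    (show (0 : ℝ) ∈ Set.Icc (-(Real.pi / 2)) (Real.pi / 2) from
      ⟨by linarith [Real.pi_pos], by linarith [Real.pi_pos]⟩) hc0 (sub_nonneg.2 hc1) (by ring)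
  simp only [smul_eq_mul, Real.cos_zero, mul_zero, add_zero, Real.one_rpow, mul_one] at h1 h2
  exact h1.trans h2

lemma re_rpow_le_re_exp_mul_log {c : ℝ} (hc0 : 0 ≤ c) (hc1 : c ≤ 1) {u : ℂ} (hu : 0 < u.re) :
    u.re ^ c ≤ (Complex.exp (c * Complex.log u)).re := by
  have hu0 : u ≠ 0 := by rintro rfl; simp at hu
  have hn : 0 < ‖u‖ := norm_pos_iff.2 hu0
  have harg := (Complex.abs_arg_lt_pi_div_two_iff.2 (Or.inl hu)).le
  have hcos : u.re = ‖u‖ * Real.cos u.arg := (Complex.norm_mul_cos_arg u).symm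
  have hcos0 : 0 ≤ Real.cos u.arg := Real.cos_nonneg_of_mem_Icc (abs_le.1 harg)
  have h1 : (Complex.exp (c * Complex.log u)).re = ‖u‖ ^ c * Real.cos (c * u.arg) := by
    rw [Complex.exp_re, Real.rpow_def_of_pos hn]
    simp [Complex.log_re, Complex.log_im, mul_comm]
  rw [h1]
  nth_rewrite 1 [hcos]
  rw [Real.mul_rpow hn.le hcos0]
  gcongr
  exact cos_rpow_le_cos_mul hc0 hc1 harg

/-! ### Representation of `f'` and the three estimates -/

/-- For `f` in the class, `f' = ((1 - αw) / (1 - βw)) ^ ((2 - 2γ) / (β - α))` with `‖w‖ ≤ ‖z‖`. -/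
lemma exists_deriv_eq_exp {α β γ : ℝ} (hα : -1 < α) (hαβ : α < β) (hβ : β < 1)
    (hγ1 : γ < 1) {f : ℂ → ℂ} (hf : f ∈ CVsnail α β γ) {z : ℂ} (hz : z ∈ unitDisc) :
    ∃ u w : ℂ, ‖w‖ ≤ ‖z‖ ∧ u * (1 - β * w) = 1 - α * w ∧
      deriv f z = Complex.exp (((2 - 2 * γ) / (β - α) : ℝ) * Complex.log u) := by
  obtain ⟨⟨hfd, -, hf1⟩, hne, ω, -, hωm, -, hω⟩ := hf
  unfold unitDisc at *
  have hfd' : DifferentiableOn ℂ (deriv f) (ball 0 1) := hfd.deriv isOpen_ball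
  obtain ⟨g, hg0, hg⟩ := exists_analytic_log hfd' hne hf1
  set c : ℝ := (2 - 2 * γ) / (β - α) with hc
  have hc0 : c ≠ 0 := (div_pos (by linarith) (by linarith)).ne'
  have hcC : (c : ℂ) ≠ 0 := by exact_mod_cast hc0
  have hcβ : (c : ℂ) * (β - α) = 2 - 2 * γ := by
    have : c * (β - α) = 2 - 2 * γ := div_mul_cancel₀ _ (sub_pos.2 hαβ).ne'
    exact_mod_cast this
  set u : ℂ → ℂ := fun z => Complex.exp (g z / c) with hu
  have hud : ∀ z ∈ ball (0 : ℂ) 1,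
      HasDerivAt u (u z * (deriv (deriv f) z / deriv f z / c)) z := fun z hz =>
    ((hg z hz).1.div_const (c : ℂ)).cexp
  have hu0 : u 0 = 1 := by simp [hu, hg0]
  have hωn : ∀ z ∈ ball (0 : ℂ) 1, ‖ω z‖ < 1 := fun z hz => by simpa using hωm hz
  have hsub : ∀ t : ℝ, |t| < 1 → ∀ x : ℂ, ‖x‖ < 1 → 1 - (t : ℂ) * x ≠ 0 := by
    intro t ht x hx h
    have h1 : ‖(t : ℂ) * x‖ = 1 := by rw [← sub_eq_zero.1 h, norm_one]
    rw [norm_mul, Complex.norm_real, Real.norm_eq_abs] at h1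
    nlinarith [abs_nonneg t, norm_nonneg x]
  have hα' : |α| < 1 := abs_lt.2 ⟨hα, by linarith⟩
  have hβ' : |β| < 1 := abs_lt.2 ⟨by linarith, hβ⟩
  have hM := exists_moebius_of_starlike hα hαβ hβ (u := u) (ω := ω)
    (fun z hz => (hud z hz).differentiableAt.differentiableWithinAt) hu0 hωn (by
      intro z hz
      have h1 : z * deriv (deriv f) z / deriv f z = snailL α β γ (ω z) := by
        simpa [snailT] using hω z hz
      have h2 := hsub α hα' _ (hωn z hz)
      have h3 := hsub β hβ' _ (hωn z hz)
      have h4 : z * deriv (deriv f) z / deriv f z * ((1 - α * ω z) * (1 - β * ω z)) =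
          c * (β - α) * ω z := by
        rw [h1, snailL, div_mul_cancel₀ _ (mul_ne_zero h2 h3), hcβ]
      rw [(hud z hz).deriv]
      calc _ = u z / c * (z * deriv (deriv f) z / deriv f z *
            ((1 - α * ω z) * (1 - β * ω z))) := by ring
        _ = _ := by
          rw [h4]
          field_simp)
  have hre : ∀ z ∈ ball (0 : ℂ) 1, 0 < (u z).re := by
    intro z hz
    obtain ⟨w, hw, hw'⟩ := hM z hz
    exact (div_pos (by linarith) (by linarith)).trans
      (moebius_re_arg hα hαβ hβ (by simpa using hz) hw hw').1
  -- As `Re u > 0`, the principal logarithm of `u` is analytic; it agrees with `g / c` at 0 and has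
  -- the same derivative.
  have hlog : Complex.log (u z) = g z / c := by
    refine isOpen_ball.eqOn_of_deriv_eq (convex_ball (0 : ℂ) 1).isPreconnected
      (f := fun z => Complex.log (u z)) (g := fun z => g z / c) ?_ ?_ ?_
      (show (0 : ℂ) ∈ ball 0 1 by simp) ?_ hz
    · exact fun z hz => ((hud z hz).clog (Or.inl (hre z hz))).differentiableAt.differentiableWithinAt
    · exact fun z hz => ((hg z hz).1.div_const (c : ℂ)).differentiableAt.differentiableWithinAt
    · intro z hz
      rw [((hud z hz).clog (Or.inl (hre z hz))).deriv, ((hg z hz).1.div_const (c : ℂ)).deriv]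
      exact mul_div_cancel_left₀ _ (Complex.exp_ne_zero _)
    · simp [hu0, hg0]
  obtain ⟨w, hw, hw'⟩ := hM z hz
  refine ⟨u z, w, hw, hw', ?_⟩
  rw [hlog, mul_div_cancel₀ _ hcC, ← (hg z hz).2]

end PascalSnail

theorem mainTheorem12 (α β γ : ℝ) (hα : -1 < α) (hαβ : α < β) (hβ : β < 1)
    (hγ0 : 0 ≤ γ) (hγ1 : γ < 1) (hγT : PascalSnail.snailT0 α β ≤ γ)
    (f : ℂ → ℂ) (hf : f ∈ PascalSnail.CVsnail α β γ) :
    (PascalSnail.snailT0 α β ≤ 1 - (β - α) / 2 → 1 - (β - α) / 2 ≤ γ →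
      ∀ z ∈ PascalSnail.unitDisc,
        ((1 + α) / (1 + β)) ^ ((2 - 2 * γ) / (β - α)) < (deriv f z).re) ∧
    (∀ z ∈ PascalSnail.unitDisc,
      (1 + α) / (1 + β) <
        ((deriv f z) ^ (((β - α) / (2 - 2 * γ) : ℝ) : ℂ)).re) ∧
    (∀ z ∈ PascalSnail.unitDisc,
      |Complex.arg (deriv f z)| ≤
        2 * (1 - γ) / (β - α) *
          Real.arcsin (‖z‖ * (β - α) / (1 - ‖z‖ ^ 2 * (α * β)))) := by
  have hc0 : 0 < (2 - 2 * γ) / (β - α) := div_pos (by linarith) (by linarith)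
  have ha : 0 < (1 + α) / (1 + β) := div_pos (by linarith) (by linarith)
  have main : ∀ z ∈ PascalSnail.unitDisc, ∃ u : ℂ,
      (1 + α) / (1 + β) < u.re ∧
      |u.arg| ≤ Real.arcsin (‖z‖ * (β - α) / (1 - ‖z‖ ^ 2 * (α * β))) ∧
      deriv f z = Complex.exp (((2 - 2 * γ) / (β - α) : ℝ) * Complex.log u) ∧
      Complex.log (deriv f z) = ((2 - 2 * γ) / (β - α) : ℝ) * Complex.log u := by
    intro z hz
    have hz1 : ‖z‖ < 1 := by simpa [PascalSnail.unitDisc] using hz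
    obtain ⟨u, w, hw, hw', hu⟩ := PascalSnail.exists_deriv_eq_exp hα hαβ hβ hγ1 hf hz
    obtain ⟨h1, h2⟩ := PascalSnail.moebius_re_arg hα hαβ hβ hz1 hw hw'
    refine ⟨u, h1, h2, hu, ?_⟩
    -- This makes `c Log u` the principal logarithm of `f'`.
    have h3 : |(2 - 2 * γ) / (β - α) * u.arg| < Real.pi := by
      rw [abs_mul, abs_of_pos hc0]
      exact (mul_le_mul_of_nonneg_left h2 hc0.le).trans_lt
        (PascalSnail.mul_arcsin_lt_pi hα hαβ hβ hγ1 hγT (norm_nonneg z) hz1)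
    obtain ⟨h4, h5⟩ := abs_lt.1 h3
    rw [hu, Complex.log_exp]
    · rwa [Complex.im_ofReal_mul, Complex.log_im]
    · rw [Complex.im_ofReal_mul, Complex.log_im]
      exact h5.le
  refine ⟨fun _ hγ z hz => ?_, fun z hz => ?_, fun z hz => ?_⟩
  · obtain ⟨u, h1, -, h3, -⟩ := main z hz
    have hc1 : (2 - 2 * γ) / (β - α) ≤ 1 := by
      rw [div_le_one (by linarith)]
      linarith
    rw [h3]
    exact (Real.rpow_lt_rpow ha.le h1 hc0).trans_le
      (PascalSnail.re_rpow_le_re_exp_mul_log hc0.le hc1 (ha.trans h1))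
  · obtain ⟨u, h1, -, h3, h4⟩ := main z hz
    have hu0 : u ≠ 0 := by
      rintro rfl
      exact (ha.trans h1).ne' Complex.zero_re
    have hf0 : deriv f z ≠ 0 := h3 ▸ Complex.exp_ne_zero _
    rw [Complex.cpow_def_of_ne_zero hf0, h4, mul_right_comm, ← Complex.ofReal_mul,
      div_mul_div_cancel₀ (by linarith), div_self (by linarith), Complex.ofReal_one, one_mul,
      Complex.exp_log hu0]
    exact h1
  · obtain ⟨u, -, h2, -, h4⟩ := main z hz
    have h5 : (deriv f z).arg = (2 - 2 * γ) / (β - α) * u.arg := by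
      rw [← Complex.log_im, h4, Complex.im_ofReal_mul, Complex.log_im]
    rw [h5, abs_mul, abs_of_pos hc0, show 2 * (1 - γ) = 2 - 2 * γ by ring]
    exact mul_le_mul_of_nonneg_left h2 hc0.le
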